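/- **Setting.** A stream network consists of finitely many segments with a fixed flow direction. Each segment flows at its downstream end into at most one segment, there is no directed cycle, and segment $j$ has a length $\ell_j\in(0,\infty]$, where $\ell_j=\infty$ is allowed only for source segments (segments into which no segment flows). A location $u$ is a point of a segment; a junction is recorded together with the segment on which it is observed. Write $u\to v$ if water flows from $u$ to $v$ (including $u=v$), call $u,v$ flow-connected if $u\to v$ or $v\to u$, let $\wedge u=\{r: r\to u\}$ be the upstream set of $u$, let $dr$ be the length measure on the network and $d(u,v)$ the hydrologic distance, i.e. the distance measured along the stream. Let $w>0$ be weights, constant on each segment, satisfying the additivity constraint: the weight of a segment into which other segments flow is the sum of the weights of those segments. Let $B$ be a Brownian motion on the network: increments over disjoint pieces of segments are independent, an increment over a piece is centred Gaussian with variance the length of the piece, and paths are almost surely continuous along each segment. The tail-up model with deterministic mean $\mu$ and moving average function $m$ is $$Y(u)=\mu(u)+\int_{\wedge u} m(d(r,u))\sqrt{\frac{w(r)}{w(u)}}\,dB(r),$$ a Wiener integral, where it is understood that the integrand is square integrable on $\wedge u$ for every $u$. Let $\Sigma(u,v)=\mathrm{Cov}(Y(u),Y(v))$. **Lemma (tail-up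 covariance).** 1. For all locations $u,v$, the variables $Y(u),Y(v)$ are square integrable, the following integrand is integrable, and $$\Sigma(u,v)=\int_{\wedge u\cap\wedge v} m(d(r,u))\,m(d(r,v))\,\frac{w(r)}{\sqrt{w(u)w(v)}}\,dr .$$ 2. Let $m(h)=\beta\exp(-h/\phi)$ with $\beta,\phi>0$. Then $$\Sigma(u,v)=\mathrm{Var}(Y(u))\sqrt{\frac{w(u)}{w(v)}}\;e^{-d(u,v)/\phi}\quad\text{if }u\to v,\qquad \Sigma(u,v)=0\quad\text{if } u,v \text{ are not flow-connected.}$$ If moreover the sources are infinitely distant ($\ell_j=\infty$ for every source segment), then the variance is the same at every location, $\mathrm{Var}(Y(u))=\sigma^2$ with $\sigma^2=\beta^2\phi/2>0$, and hence $$\Sigma(u,v)=\begin{cases}\sigma^2\sqrt{w(u)/w(v)}\;e^{-d(u,v)/\phi} & \text{if } u\to v,\\ \sigma^2\sqrt{w(v)/w(u)}\;e^{-d(u,v)/\phi} & \text{if } v\to u,\\ 0 & \text{otherwise.}\end{cases}$$ -/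

import Mathlib

open MeasureTheory ProbabilityTheory Filter
open scoped ENNReal NNReal Topology

noncomputable section

/-- A stream network with finitely many segments, indexed by `J`, and a fixed flow direction.
Each segment flows at its downstream end into at most one segment (`down j = none`: outlet),
there is no directed cycle, and every segment has a positive length.  Lengths may be infinite
only for source segments, those into which no segment flows. -/
structure StreamNetwork (J : Type*) where
  down : J → Option J
  acyclic : ∀ j, ¬ Relation.TransGen (fun i k => down i = some k) j j
  len : J → ℝ≥0∞
  len_pos : ∀ j, 0 < len j
  len_ne_top : ∀ j k, down k = some j → len j ≠ ∞

namespace StreamNetwork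

variable {J : Type*} (N : StreamNetwork J)

/-- `i` is strictly upstream of `k`. -/
def Above (i k : J) : Prop := Relation.TransGen (fun i k => N.down i = some k) i k

/-- The source segments have their sources infinitely far upstream. -/
def SourcesAtInfinity : Prop := ∀ j, (∀ k, N.down k ≠ some j) → N.len j = ∞

/-- The segment `j`, parametrised by the distance along the stream, measured upstream from
the downstream end of the segment. -/
def segment (j : J) : Set ℝ := {x | 0 ≤ x ∧ ENNReal.ofReal x ≤ N.len j}

/-- The locations of the network: a segment and a position on it.  A junction is an end point
of every segment that meets it, and is recorded together with the segment on which it is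
observed (this is what determines its weight). -/
abbrev Location : Type _ := Σ j : J, N.segment j

/-- The length measure `dr` on the network: Lebesgue measure on every segment. -/
def lengthMeasure : Measure N.Location :=
  Measure.sum fun j =>
    ((volume : Measure ℝ).comap (Subtype.val : N.segment j → ℝ)).map (Sigma.mk j)

variable {N}

/-- `u → v`: water at `u` flows to `v` (every location flows to itself). -/
def FlowsTo (u v : N.Location) : Prop :=
  (u.1 = v.1 ∧ (v.2 : ℝ) ≤ (u.2 : ℝ)) ∨ N.Above u.1 v.1

/-- The upstream set `∧u`. -/
def upstream (u : N.Location) : Set N.Location := {r | FlowsTo r u}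

/-- The downstream set `∨u`. -/
def downstream (u : N.Location) : Set N.Location := {r | FlowsTo u r}

/-- The hydrologic distance of two locations of one stream: the total length of the way along
the stream from one to the other, which runs through the points that lie downstream of
exactly one of the two. -/
def hydroDist (u v : N.Location) : ℝ :=
  (N.lengthMeasure (symmDiff (downstream u) (downstream v))).toReal

/-- Positive weights, constant on every segment, that satisfy the additivity constraint: the
weight of a segment into which other segments flow is the sum of their weights. -/
structure IsAdditiveWeight [Fintype J] [DecidableEq J] (N : StreamNetwork J) (w : J → ℝ) :
    Prop where
  pos : ∀ j, 0 < w j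
  additive : ∀ j, (∃ k, N.down k = some j) → w j = ∑ k with N.down k = some j, w k

/-- A piece `(lo, hi]` of a segment. -/
structure Piece (N : StreamNetwork J) where
  seg : J
  lo : N.segment seg
  hi : N.segment seg
  le : lo ≤ hi

/-- The set of locations that make up a piece. -/
def Piece.toSet (p : N.Piece) : Set N.Location := Sigma.mk p.seg '' Set.Ioc p.lo p.hi

variable {Ω : Type*} {mΩ : MeasurableSpace Ω}

/-- The increment of a process over a piece. -/
def Piece.increment (p : N.Piece) (B : N.Location → Ω → ℝ) (ω : Ω) : ℝ :=
  B ⟨p.seg, p.hi⟩ ω - B ⟨p.seg, p.lo⟩ ω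

/-- Brownian motion on the network: the increment over a piece is centred Gaussian with
variance the length of the piece, increments over disjoint pieces (of the same or of different
segments) are independent, and the paths are almost surely continuous along every segment. -/
structure IsBrownian (B : N.Location → Ω → ℝ) (P : Measure Ω) : Prop where
  law : ∀ p : N.Piece,
    HasLaw (p.increment B) (gaussianReal 0 (Real.toNNReal ((p.hi : ℝ) - (p.lo : ℝ)))) P
  indep : ∀ (n : ℕ) (p : Fin n → N.Piece),
    Pairwise (fun i k => Disjoint (p i).toSet (p k).toSet) →
      iIndepFun (fun i => (p i).increment B) P
  cont : ∀ᵐ ω ∂P, ∀ j, Continuous fun x : N.segment j => B ⟨j, x⟩ ω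

/-- The step function `∑ c • 1_p` on the network, for a finite family of pieces `p` with
coefficients `c`. -/
def stepFun (g : N.Piece →₀ ℝ) (r : N.Location) : ℝ :=
  g.sum fun p c => c * p.toSet.indicator 1 r

/-- The stochastic integral of a step function: `∑ c • (B (hi) - B (lo))`. -/
def stepIntegral (B : N.Location → Ω → ℝ) (g : N.Piece →₀ ℝ) (ω : Ω) : ℝ :=
  g.sum fun p c => c * p.increment B ω

/-- `I` is (a version of) the Wiener integral `∫ f dB` of a deterministic square integrable
function `f`: the mean square limit of the integrals of step functions which converge to `f`
in `L²` of the length measure. -/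
def IsWienerIntegral (B : N.Location → Ω → ℝ) (P : Measure Ω) (f : N.Location → ℝ)
    (I : Ω → ℝ) : Prop :=
  MemLp f 2 N.lengthMeasure ∧ MemLp I 2 P ∧
    ∃ g : ℕ → N.Piece →₀ ℝ,
      Tendsto (fun n => eLpNorm (fun r => stepFun (g n) r - f r) 2 N.lengthMeasure)
        atTop (𝓝 0) ∧
      Tendsto (fun n => eLpNorm (fun ω => stepIntegral B (g n) ω - I ω) 2 P) atTop (𝓝 0)

/-- The tail-up model
`Y(u) = μ(u) + ∫_{∧u} m(r - u) √(w(r) / w(u)) dB(r)`, where the moving average function `m`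
is evaluated at the distance of `r` and `u` along the stream. -/
def IsTailUp (w : J → ℝ) (m : ℝ → ℝ) (μ : N.Location → ℝ) (B Y : N.Location → Ω → ℝ)
    (P : Measure Ω) : Prop :=
  ∀ u : N.Location,
    IsWienerIntegral B P
      ((upstream u).indicator fun r => m (hydroDist r u) * √(w r.1 / w u.1))
      (fun ω => Y u ω - μ u)

end StreamNetwork

end

/-! Both parts rest on the Itô isometry: the covariance of two Wiener integrals is the `L²` inner
product of their integrands. For step functions this is bilinearity, once the covariance of two
increments is known to be the length of the common part of their pieces; mean square limits extend
it (`IsWienerIntegral.covariance_eq`).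

For the exponential kernel, distances along the stream are differences of `depth`, the distance to
the outlet. If `u → v`, then `∧u ⊆ ∧v` and `d(r,v) = d(r,u) + d(u,v)`, so a constant leaves the
variance integral. If `u`, `v` are not flow-connected, their upstream sets are disjoint, since the
way downstream is unique.

The variance at `u` is a constant times the integral over `∧u` of the discounted weight `w(r) exp(-c
* depth r)`, with `c = 2/φ`. Each segment contributes a difference of values at its two ends. By
additivity the value at an upper end is the sum of the values at the lower ends of the inflowing
segments, and it vanishes at infinitely distant sources. The sum telescopes to the value at `u`,
which cancels the normalisation (`setIntegral_upstream_exp_depth`). -/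

section L2

/-! ### Mean square continuity of inner products and covariances -/

variable {α : Type*} {mα : MeasurableSpace α} {ν : Measure α}

/-- The integral of a product is continuous in mean square. -/
theorem tendsto_integral_mul_of_tendsto_eLpNorm {f g : α → ℝ} {F G : ℕ → α → ℝ}
    (hf : MemLp f 2 ν) (hg : MemLp g 2 ν) (hF : ∀ n, MemLp (F n) 2 ν) (hG : ∀ n, MemLp (G n) 2 ν)
    (hFf : Tendsto (fun n => eLpNorm (F n - f) 2 ν) atTop (𝓝 0))
    (hGg : Tendsto (fun n => eLpNorm (G n - g) 2 ν) atTop (𝓝 0)) :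
    Tendsto (fun n => ∫ x, F n x * G n x ∂ν) atTop (𝓝 (∫ x, f x * g x ∂ν)) := by
  have key : ∀ {a b : α → ℝ} (ha : MemLp a 2 ν) (hb : MemLp b 2 ν),
      inner ℝ (ha.toLp a) (hb.toLp b) = ∫ x, a x * b x ∂ν := by
    intro a b ha hb
    rw [L2.inner_def]
    refine integral_congr_ae ?_
    filter_upwards [ha.coeFn_toLp, hb.coeFn_toLp] with x hx hy
    simp [hx, hy, mul_comm]
  simp only [← key hf hg, ← key (hF _) (hG _)]
  exact ((Lp.tendsto_Lp_iff_tendsto_eLpNorm'' F hF f hf).2 hFf).inner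
    ((Lp.tendsto_Lp_iff_tendsto_eLpNorm'' G hG g hg).2 hGg)

/-- The covariance is continuous in mean square. -/
theorem tendsto_covariance_of_tendsto_eLpNorm [IsProbabilityMeasure ν] {f g : α → ℝ}
    {F G : ℕ → α → ℝ} (hf : MemLp f 2 ν) (hg : MemLp g 2 ν)
    (hF : ∀ n, MemLp (F n) 2 ν) (hG : ∀ n, MemLp (G n) 2 ν)
    (hFf : Tendsto (fun n => eLpNorm (F n - f) 2 ν) atTop (𝓝 0))
    (hGg : Tendsto (fun n => eLpNorm (G n - g) 2 ν) atTop (𝓝 0)) :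
    Tendsto (fun n => cov[F n, G n; ν]) atTop (𝓝 cov[f, g; ν]) := by
  -- Pairing with the constant 1 gives convergence of the means.
  have h1 : MemLp (fun _ : α => (1 : ℝ)) 2 ν := memLp_const 1
  have h1' : Tendsto (fun _ : ℕ => eLpNorm ((fun _ : α => (1 : ℝ)) - fun _ => 1) 2 ν)
      atTop (𝓝 0) := by simp
  have a := tendsto_integral_mul_of_tendsto_eLpNorm hf hg hF hG hFf hGg
  have b := tendsto_integral_mul_of_tendsto_eLpNorm hf h1 hF (fun _ => h1) hFf h1'
  have c := tendsto_integral_mul_of_tendsto_eLpNorm hg h1 hG (fun _ => h1) hGg h1'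
  simp only [mul_one] at b c
  simp only [covariance_eq_sub hf hg, covariance_eq_sub (hF _) (hG _)]
  exact a.sub (b.mul c)

end L2

/-! ### The length measure and pieces of segments -/

namespace StreamNetwork

variable {J : Type*} {N : StreamNetwork J}

/-- The downstream end of a segment. -/
noncomputable def segBot (N : StreamNetwork J) (j : J) : N.segment j := ⟨0, le_rfl, by simp⟩

/-- The inclusion of a segment into the network. -/
abbrev loc (N : StreamNetwork J) (j : J) : N.segment j → N.Location :=
  Sigma.mk (β := fun j => N.segment j) j

theorem measurableSet_segment (j : J) : MeasurableSet (N.segment j) :=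
  measurableSet_Ici.inter (measurableSet_le ENNReal.measurable_ofReal measurable_const)

theorem measurableSet_location {s : Set N.Location} :
    MeasurableSet s ↔ ∀ j, MeasurableSet (N.loc j ⁻¹' s) := by
  change MeasurableSet[⨅ j, _] s ↔ _
  rw [MeasurableSpace.measurableSet_iInf]
  rfl

theorem measurable_location_mk (j : J) : Measurable (N.loc j) :=
  fun _ hs => measurableSet_location.1 hs j

theorem measurable_location {β : Type*} [MeasurableSpace β] {f : N.Location → β}
    (hf : ∀ j, Measurable fun x : N.segment j => f ⟨j, x⟩) : Measurable f :=
  fun _ hs => measurableSet_location.2 fun j => hf j hs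

theorem lengthMeasure_apply [Fintype J] {s : Set N.Location} (hs : MeasurableSet s) :
    N.lengthMeasure s = ∑ j, volume (Subtype.val '' (N.loc j ⁻¹' s : Set (N.segment j))) := by
  rw [lengthMeasure, Measure.sum_apply _ hs, tsum_fintype]
  refine Finset.sum_congr rfl fun j _ => ?_
  rw [Measure.map_apply (measurable_location_mk j) hs,
    comap_subtype_coe_apply (measurableSet_segment j)]

theorem integral_lengthMeasure [Fintype J] {f : N.Location → ℝ}
    (hf : Integrable f N.lengthMeasure) (hfm : Measurable f) :
    ∫ r, f r ∂N.lengthMeasure =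
      ∑ j, ∫ x : N.segment j, f ⟨j, x⟩ ∂((volume : Measure ℝ).comap Subtype.val) := by
  rw [lengthMeasure] at hf ⊢
  rw [integral_sum_measure hf, tsum_fintype]
  refine Finset.sum_congr rfl fun j _ => ?_
  rw [integral_map (measurable_location_mk j).aemeasurable hfm.aestronglyMeasurable]

theorem Piece.preimage_toSet_self (p : N.Piece) :
    N.loc p.seg ⁻¹' p.toSet = Set.Ioc p.lo p.hi :=
  Set.preimage_image_eq _ sigma_mk_injective

theorem Piece.preimage_toSet_of_ne (p : N.Piece) {j : J} (h : j ≠ p.seg) :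
    (N.loc j ⁻¹' p.toSet : Set (N.segment j)) = ∅ := by
  ext x
  simp only [Piece.toSet, Set.mem_preimage, Set.mem_image, Set.mem_empty_iff_false, iff_false]
  rintro ⟨y, -, hy⟩
  exact h (congrArg Sigma.fst hy).symm

theorem Piece.measurableSet_toSet (p : N.Piece) : MeasurableSet p.toSet := by
  refine measurableSet_location.2 fun j => ?_
  by_cases h : j = p.seg
  · subst h
    rw [p.preimage_toSet_self]
    exact measurableSet_Ioc
  · rw [p.preimage_toSet_of_ne h]
    exact MeasurableSet.empty

theorem Piece.disjoint_of_seg_ne {p q : N.Piece} (h : p.seg ≠ q.seg) :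
    Disjoint p.toSet q.toSet := by
  rw [Set.disjoint_left]
  rintro _ ⟨x, -, rfl⟩ ⟨y, -, hy⟩
  exact h (congrArg Sigma.fst hy).symm

theorem image_val_Ioc {j : J} (a b : N.segment j) :
    Subtype.val '' Set.Ioc a b = Set.Ioc (a : ℝ) b := by
  ext x
  constructor
  · rintro ⟨y, hy, rfl⟩
    exact hy
  · intro hx
    exact ⟨⟨x, a.2.1.trans hx.1.le, (ENNReal.ofReal_le_ofReal hx.2).trans b.2.2⟩, hx, rfl⟩

/-- No order of `a` and `b` is assumed: for `b ≤ a` both sides vanish. This covers intersections of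
disjoint pieces of one segment. -/
theorem lengthMeasure_Ioc [Fintype J] {j : J} (a b : N.segment j) :
    N.lengthMeasure (N.loc j '' Set.Ioc a b) = ENNReal.ofReal ((b : ℝ) - a) := by
  classical
  rcases le_or_gt a b with hab | hab
  · let p : N.Piece := ⟨j, a, b, hab⟩
    change N.lengthMeasure p.toSet = _
    rw [lengthMeasure_apply p.measurableSet_toSet, Finset.sum_eq_single j]
    · rw [show (N.loc j ⁻¹' p.toSet : Set (N.segment j)) = Set.Ioc a b from
        p.preimage_toSet_self, image_val_Ioc, Real.volume_Ioc]
    · intro k _ hk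
      rw [p.preimage_toSet_of_ne hk]
      simp
    · simp
  · rw [Set.Ioc_eq_empty (by simpa using hab.le), Set.image_empty, measure_empty,
      ENNReal.ofReal_of_nonpos]
    exact sub_nonpos.2 hab.le

theorem Piece.lengthMeasure_toSet [Fintype J] (p : N.Piece) :
    N.lengthMeasure p.toSet = ENNReal.ofReal ((p.hi : ℝ) - p.lo) :=
  lengthMeasure_Ioc p.lo p.hi

/-! ### Brownian increments and the Itô isometry -/

section Brownian

variable {Ω : Type*} {mΩ : MeasurableSpace Ω} {P : Measure Ω} {B : N.Location → Ω → ℝ}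

theorem IsBrownian.memLp_increment (hB : IsBrownian B P) (p : N.Piece) :
    MemLp (p.increment B) 2 P := by
  have h := hB.law p
  have : MemLp (id : ℝ → ℝ) 2 (P.map (p.increment B)) := by
    rw [h.map_eq]
    exact memLp_id_gaussianReal 2
  exact (memLp_map_measure_iff aestronglyMeasurable_id h.aemeasurable).1 this

theorem IsBrownian.variance_increment (hB : IsBrownian B P) (p : N.Piece) :
    Var[p.increment B; P] = p.hi - p.lo := by
  rw [(hB.law p).variance_eq, variance_id_gaussianReal]
  exact Real.coe_toNNReal _ (sub_nonneg.2 p.le)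

/-- The piece of a segment between its downstream end and a position on it. -/
noncomputable def initialPiece {j : J} (x : N.segment j) : N.Piece := ⟨j, N.segBot j, x, x.2.1⟩

/-- Polarisation: for `x ≤ y` the variance `y - x` of the increment from `x` to `y` equals `y + x -
2 cov`. Within one segment only the law of increments is needed; independence serves for different
segments. -/
theorem IsBrownian.covariance_initialPiece [IsProbabilityMeasure P] (hB : IsBrownian B P) {j : J}
    (x y : N.segment j) :
    cov[(initialPiece x).increment B, (initialPiece y).increment B; P] = min (x : ℝ) y := by
  have of_le : ∀ x y : N.segment j, x ≤ y →
      cov[(initialPiece x).increment B, (initialPiece y).increment B; P] = x := by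
    intro x y hxy
    have hx := hB.memLp_increment (initialPiece x)
    have hy := hB.memLp_increment (initialPiece y)
    have h := hB.variance_increment ⟨j, x, y, hxy⟩
    have e : Piece.increment ⟨j, x, y, hxy⟩ B =
        (initialPiece y).increment B - (initialPiece x).increment B := by
      ext ω
      simp [Piece.increment, initialPiece]
    rw [e, variance_sub hy hx, hB.variance_increment, hB.variance_increment,
      covariance_comm] at h
    simp only [initialPiece, segBot] at h ⊢
    linarith
  rcases le_total x y with h | h
  · rw [of_le x y h, min_eq_left (show (x : ℝ) ≤ y from h)]
  · rw [covariance_comm, of_le y x h, min_eq_right (show (y : ℝ) ≤ x from h)]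

/-- The covariance of two increments is the length of the common part of the pieces. -/
theorem IsBrownian.covariance_increment [Fintype J] [IsProbabilityMeasure P]
    (hB : IsBrownian B P) (p q : N.Piece) :
    cov[p.increment B, q.increment B; P] = N.lengthMeasure.real (p.toSet ∩ q.toSet) := by
  by_cases h : p.seg = q.seg
  · obtain ⟨j, a, b, hab⟩ := p
    obtain ⟨k, c, d, hcd⟩ := q
    dsimp only at h
    subst h
    have e : ∀ a b : N.segment j, ∀ h, Piece.increment ⟨j, a, b, h⟩ B =
        (initialPiece b).increment B - (initialPiece a).increment B := by
      intro a b h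
      ext ω
      simp [Piece.increment, initialPiece]
    have hm := fun x : N.segment j => hB.memLp_increment (initialPiece x)
    rw [e, e, covariance_sub_sub (hm _) (hm _) (hm _) (hm _)]
    simp only [hB.covariance_initialPiece]
    have hset : Piece.toSet ⟨j, a, b, hab⟩ ∩ Piece.toSet ⟨j, c, d, hcd⟩ =
        N.loc j '' Set.Ioc (max a c) (min b d) := by
      rw [← Set.Ioc_inter_Ioc, Set.image_inter sigma_mk_injective]
      rfl
    have hmax : ((max a c : N.segment j) : ℝ) = max (a : ℝ) c :=
      (Subtype.mono_coe _).map_max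
    have hmin : ((min b d : N.segment j) : ℝ) = min (b : ℝ) d :=
      (Subtype.mono_coe _).map_min
    rw [hset, measureReal_def, lengthMeasure_Ioc, ENNReal.toReal_ofReal', hmax, hmin]
    -- What remains is `min b d - min b c - min a d + min a c = max (min b d - max a c) 0`, which
    -- needs `a ≤ b` and `c ≤ d`.
    have hab' : (a : ℝ) ≤ b := hab
    have hcd' : (c : ℝ) ≤ d := hcd
    grind
  · have hd := Piece.disjoint_of_seg_ne h
    have hi := hB.indep 2 ![p, q] (by
      intro i k hik
      fin_cases i <;> fin_cases k <;> simp_all [hd.symm])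
    have hpq : IndepFun (p.increment B) (q.increment B) P :=
      hi.indepFun (i := 0) (j := 1) (by simp)
    rw [hpq.covariance_eq_zero (hB.memLp_increment p) (hB.memLp_increment q), hd.inter_eq]
    simp

theorem memLp_indicator_toSet [Fintype J] (p : N.Piece) (c : ℝ) :
    MemLp (fun r => c * p.toSet.indicator 1 r) 2 N.lengthMeasure := by
  refine MemLp.const_mul ?_ c
  exact memLp_indicator_const 2 p.measurableSet_toSet (1 : ℝ)
    (Or.inr (by rw [p.lengthMeasure_toSet]; exact ENNReal.ofReal_ne_top))

theorem memLp_stepFun [Fintype J] (g : N.Piece →₀ ℝ) : MemLp (stepFun g) 2 N.lengthMeasure :=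
  memLp_finsetSum _ fun p _ => memLp_indicator_toSet p (g p)

theorem IsBrownian.memLp_stepIntegral (hB : IsBrownian B P) (g : N.Piece →₀ ℝ) :
    MemLp (stepIntegral B g) 2 P :=
  memLp_finsetSum _ fun p _ => (hB.memLp_increment p).const_mul (g p)

/-- The Itô isometry for step functions. -/
theorem IsBrownian.covariance_stepIntegral [Fintype J] [IsProbabilityMeasure P]
    (hB : IsBrownian B P) (f g : N.Piece →₀ ℝ) :
    cov[stepIntegral B f, stepIntegral B g; P] =
      ∫ r, stepFun f r * stepFun g r ∂N.lengthMeasure := by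
  have hI : ∀ p q : N.Piece, ∀ c d : ℝ,
      Integrable (fun r => (c * p.toSet.indicator 1 r) * (d * q.toSet.indicator 1 r))
        N.lengthMeasure := fun p q c d =>
    (memLp_indicator_toSet p c).integrable_mul (memLp_indicator_toSet q d)
  have hL : cov[stepIntegral B f, stepIntegral B g; P] =
      ∑ p ∈ f.support, ∑ q ∈ g.support, f p * (g q * N.lengthMeasure.real (p.toSet ∩ q.toSet)) := by
    unfold stepIntegral Finsupp.sum
    rw [covariance_fun_sum_fun_sum' (fun p _ => (hB.memLp_increment p).const_mul (f p))
      (fun q _ => (hB.memLp_increment q).const_mul (g q))]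
    simp only [covariance_const_mul_left, covariance_const_mul_right, hB.covariance_increment]
    simp only [mul_left_comm]
  rw [hL]
  unfold stepFun Finsupp.sum
  simp only [Finset.sum_mul_sum]
  rw [integral_finsetSum _ fun p _ => integrable_finsetSum _ fun q _ => hI p q _ _]
  refine Finset.sum_congr rfl fun p _ => ?_
  rw [integral_finsetSum _ fun q _ => hI p q _ _]
  refine Finset.sum_congr rfl fun q _ => ?_
  have e : (fun r => f p * p.toSet.indicator 1 r * (g q * q.toSet.indicator 1 r)) =
      fun r => f p * (g q * (p.toSet ∩ q.toSet).indicator 1 r) := by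
    ext r
    rw [Set.inter_indicator_one]
    simp only [Pi.mul_apply]
    ring
  rw [e, integral_const_mul, integral_const_mul,
    integral_indicator_one (p.measurableSet_toSet.inter q.measurableSet_toSet)]

/-- The Itô isometry. -/
theorem IsWienerIntegral.covariance_eq [Fintype J] [IsProbabilityMeasure P]
    (hB : IsBrownian B P) {f g : N.Location → ℝ} {X Z : Ω → ℝ}
    (hf : IsWienerIntegral B P f X) (hg : IsWienerIntegral B P g Z) :
    cov[X, Z; P] = ∫ r, f r * g r ∂N.lengthMeasure := by
  obtain ⟨hf2, hX, F, hFf, hFX⟩ := hf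
  obtain ⟨hg2, hZ, G, hGg, hGZ⟩ := hg
  have h1 := tendsto_covariance_of_tendsto_eLpNorm hX hZ
    (fun n => hB.memLp_stepIntegral (F n)) (fun n => hB.memLp_stepIntegral (G n)) hFX hGZ
  have h2 := tendsto_integral_mul_of_tendsto_eLpNorm hf2 hg2
    (fun n => memLp_stepFun (F n)) (fun n => memLp_stepFun (G n)) hFf hGg
  simp only [hB.covariance_stepIntegral] at h1
  exact tendsto_nhds_unique h1 h2

end Brownian

end StreamNetwork

/-! ### The flow order, upstream and downstream sets -/

namespace StreamNetwork

variable {J : Type*} {N : StreamNetwork J}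

theorem Above.trans {i j k : J} (h : N.Above i j) (h' : N.Above j k) : N.Above i k :=
  Relation.TransGen.trans h h'

theorem Above.ne {i j : J} (h : N.Above i j) : i ≠ j := by
  rintro rfl
  exact N.acyclic _ h

theorem Above.len_ne_top {i j : J} (h : N.Above i j) : N.len j ≠ ∞ := by
  obtain ⟨k, -, hk⟩ := Relation.TransGen.tail'_iff.1 h
  exact N.len_ne_top j k hk

/-- Since `down` is a function, the segments below `r` form a single chain. -/
theorem Above.total {r i k : J} (hi : N.Above r i) (hk : N.Above r k) :
    i = k ∨ N.Above i k ∨ N.Above k i := by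
  have hu : Relator.RightUnique (fun i k => N.down i = some k) := by
    intro a b c hb hc
    exact Option.some.inj (hb.symm.trans hc)
  rcases Relation.ReflTransGen.total_of_right_unique hu hi.to_reflTransGen
    hk.to_reflTransGen with h | h <;>
  rcases Relation.reflTransGen_iff_eq_or_transGen.1 h with h | h
  · exact Or.inl h.symm
  · exact Or.inr (Or.inl h)
  · exact Or.inl h
  · exact Or.inr (Or.inr h)

theorem above_iff_of_down {i k l : J} (h : N.down i = some k) :
    N.Above i l ↔ l = k ∨ N.Above k l := by
  constructor
  · intro hl
    obtain ⟨m, hm, hml⟩ := Relation.TransGen.head'_iff.1 hl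
    obtain rfl : k = m := Option.some.inj (h.symm.trans hm)
    exact Relation.reflTransGen_iff_eq_or_transGen.1 hml
  · rintro (rfl | hl)
    · exact Relation.TransGen.single h
    · exact Relation.TransGen.head h hl

theorem above_iff_exists_down {i j : J} :
    N.Above i j ↔ ∃ k, N.down i = some k ∧ (k = j ∨ N.Above k j) := by
  constructor
  · intro h
    obtain ⟨m, hm, -⟩ := Relation.TransGen.head'_iff.1 h
    exact ⟨m, hm, ((above_iff_of_down hm).1 h).imp_left Eq.symm⟩
  · rintro ⟨k, hk, h⟩
    exact (above_iff_of_down hk).2 (h.imp_left Eq.symm)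

theorem FlowsTo.trans {u v r : N.Location} (h : FlowsTo u v) (h' : FlowsTo v r) :
    FlowsTo u r := by
  rcases h with ⟨h, hx⟩ | h <;> rcases h' with ⟨h', hx'⟩ | h'
  · exact Or.inl ⟨h.trans h', hx'.trans hx⟩
  · exact Or.inr (h ▸ h')
  · exact Or.inr (h' ▸ h)
  · exact Or.inr (h.trans h')

/-- Two locations downstream of a third one are flow-connected. -/
theorem FlowsTo.total {r u v : N.Location} (hu : FlowsTo r u) (hv : FlowsTo r v) :
    FlowsTo u v ∨ FlowsTo v u := by
  have same : u.1 = v.1 → FlowsTo u v ∨ FlowsTo v u := fun h =>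
    (le_total (v.2 : ℝ) u.2).imp (fun h' => Or.inl ⟨h, h'⟩) fun h' => Or.inl ⟨h.symm, h'⟩
  rcases hu with ⟨hu, -⟩ | hu <;> rcases hv with ⟨hv, -⟩ | hv
  · exact same (hu.symm.trans hv)
  · exact Or.inl (Or.inr (hu ▸ hv))
  · exact Or.inr (Or.inr (hv ▸ hu))
  · rcases hu.total hv with h | h | h
    · exact same h
    · exact Or.inl (Or.inr h)
    · exact Or.inr (Or.inr h)

theorem preimage_upstream_self {j : J} (x : N.segment j) :
    N.loc j ⁻¹' upstream ⟨j, x⟩ = Set.Ici x := by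
  ext y
  constructor
  · rintro (⟨-, h⟩ | h)
    · exact h
    · exact absurd rfl h.ne
  · exact fun h => Or.inl ⟨rfl, h⟩

theorem preimage_upstream_of_above {u : N.Location} {k : J} (h : N.Above k u.1) :
    N.loc k ⁻¹' upstream u = Set.univ :=
  Set.eq_univ_of_forall fun _ => Or.inr h

theorem preimage_upstream_of_not_above {u : N.Location} {k : J} (h : ¬ N.Above k u.1)
    (h' : k ≠ u.1) : N.loc k ⁻¹' upstream u = ∅ :=
  Set.eq_empty_of_forall_notMem fun _ hx => hx.elim (fun e => h' e.1) h

theorem measurableSet_upstream (u : N.Location) : MeasurableSet (upstream u) := by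
  obtain ⟨j, x⟩ := u
  refine measurableSet_location.2 fun k => ?_
  by_cases hk : k = j
  · subst hk
    exact (preimage_upstream_self x).symm ▸ measurableSet_Ici
  · by_cases h : N.Above k j
    · exact (preimage_upstream_of_above (u := ⟨j, x⟩) h).symm ▸ MeasurableSet.univ
    · exact (preimage_upstream_of_not_above (u := ⟨j, x⟩) h hk).symm ▸ MeasurableSet.empty

theorem preimage_downstream_self {j : J} (x : N.segment j) :
    N.loc j ⁻¹' downstream ⟨j, x⟩ = Set.Iic x := by
  ext y
  constructor
  · rintro (⟨-, h⟩ | h)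
    · exact h
    · exact absurd rfl h.ne
  · exact fun h => Or.inl ⟨rfl, h⟩

theorem preimage_downstream_of_above {u : N.Location} {k : J} (h : N.Above u.1 k) :
    N.loc k ⁻¹' downstream u = Set.univ :=
  Set.eq_univ_of_forall fun _ => Or.inr h

theorem preimage_downstream_of_not_above {u : N.Location} {k : J} (h : ¬ N.Above u.1 k)
    (h' : k ≠ u.1) : N.loc k ⁻¹' downstream u = ∅ :=
  Set.eq_empty_of_forall_notMem fun _ hx => hx.elim (fun e => h' e.1.symm) h

theorem measurableSet_downstream (u : N.Location) : MeasurableSet (downstream u) := by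
  obtain ⟨j, x⟩ := u
  refine measurableSet_location.2 fun k => ?_
  by_cases hk : k = j
  · subst hk
    exact (preimage_downstream_self x).symm ▸ measurableSet_Iic
  · by_cases h : N.Above j k
    · exact (preimage_downstream_of_above (u := ⟨j, x⟩) h).symm ▸ MeasurableSet.univ
    · exact (preimage_downstream_of_not_above (u := ⟨j, x⟩) h hk).symm ▸ MeasurableSet.empty

theorem segment_eq_Icc {j : J} (h : N.len j ≠ ∞) : N.segment j = Set.Icc 0 (N.len j).toReal := by
  ext x
  simp only [segment, Set.mem_ofPred_eq, Set.mem_Icc, ENNReal.ofReal_le_iff_le_toReal h]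

theorem segment_eq_Ici {j : J} (h : N.len j = ∞) : N.segment j = Set.Ici 0 := by
  ext x
  simp [segment, h]

theorem image_val_Iic {j : J} (x : N.segment j) :
    Subtype.val '' Set.Iic x = Set.Icc 0 (x : ℝ) := by
  ext y
  constructor
  · rintro ⟨z, hz, rfl⟩
    exact ⟨z.2.1, hz⟩
  · intro hy
    exact ⟨⟨y, hy.1, (ENNReal.ofReal_le_ofReal hy.2).trans x.2.2⟩, hy.2, rfl⟩

/-- A primitive evaluated at two ends; `b` will be the depth of the lower end of the segment. The
case distinction is essential because `(∞).toReal = 0`, whereas the boundary term at infinity is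
zero. -/
theorem setIntegral_exp_segment {c : ℝ} (hc : 0 < c) (b : ℝ) {j : J} {x : ℝ} (hx : x ∈ N.segment j) :
    ∫ y in N.segment j ∩ Set.Ici x, Real.exp (-c * (b + y)) =
      (Real.exp (-c * (b + x)) -
        if N.len j = ∞ then 0 else Real.exp (-c * (b + (N.len j).toReal))) / c := by
  have e : ∀ y : ℝ, Real.exp (-c * (b + y)) = Real.exp (-c * b) * Real.exp (-c * y) := by
    intro y
    rw [← Real.exp_add]
    ring_nf
  split_ifs with h
  · rw [segment_eq_Ici h, Set.Ici_inter_Ici, sup_of_le_right (by exact hx.1),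
      integral_Ici_eq_integral_Ioi]
    simp only [e]
    rw [integral_const_mul, integral_exp_mul_Ioi (by linarith)]
    field_simp
    ring
  · have hxl : x ≤ (N.len j).toReal := (ENNReal.ofReal_le_iff_le_toReal h).1 hx.2
    have hset : N.segment j ∩ Set.Ici x = Set.Icc x (N.len j).toReal := by
      rw [segment_eq_Icc h]
      ext y
      have := hx.1
      simp only [Set.mem_inter_iff, Set.mem_Icc, Set.mem_Ici]
      constructor
      · rintro ⟨⟨-, h1⟩, h2⟩
        exact ⟨h2, h1⟩
      · rintro ⟨h1, h2⟩
        exact ⟨⟨this.trans h1, h2⟩, h1⟩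
    rw [hset, integral_Icc_eq_integral_Ioc, ← intervalIntegral.integral_of_le hxl]
    simp only [e]
    rw [intervalIntegral.integral_const_mul,
      intervalIntegral.integral_comp_mul_left (fun y => Real.exp y) (neg_ne_zero.2 hc.ne'),
      integral_exp, smul_eq_mul]
    field_simp
    ring

/-! ### Depth, hydrologic distance and the telescoping sum -/

section Depth

variable [Fintype J]

open Classical in
/-- The length of the way from the downstream end of a segment to the outlet. -/
noncomputable def baseDepth (N : StreamNetwork J) (j : J) : ℝ := ∑ k with N.Above j k, (N.len k).toReal

/-- The length of the way from a location to the outlet. -/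
noncomputable def depth (u : N.Location) : ℝ := N.baseDepth u.1 + u.2

theorem baseDepth_of_down {i k : J} (h : N.down i = some k) :
    N.baseDepth i = N.baseDepth k + (N.len k).toReal := by
  classical
  have e : Finset.univ.filter (fun l => N.Above i l) =
      insert k (Finset.univ.filter fun l => N.Above k l) := by
    ext l
    simp [above_iff_of_down h]
  unfold baseDepth
  rw [e, Finset.sum_insert (by simpa using fun h : N.Above k k => h.ne rfl), add_comm]

/-- The downstream set is the lower part of the location's own segment together with all segments
below it, in full. -/
theorem lengthMeasure_downstream (u : N.Location) :
    N.lengthMeasure (downstream u) = ENNReal.ofReal (depth u) := by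
  classical
  obtain ⟨j, x⟩ := u
  rw [lengthMeasure_apply (measurableSet_downstream _),
    ← Finset.add_sum_erase _ _ (Finset.mem_univ j), depth, baseDepth, add_comm (Finset.sum _ _),
    ENNReal.ofReal_add x.2.1 (Finset.sum_nonneg fun _ _ => ENNReal.toReal_nonneg)]
  congr 1
  · rw [preimage_downstream_self, image_val_Iic, Real.volume_Icc, sub_zero]
  · rw [ENNReal.ofReal_sum_of_nonneg fun _ _ => ENNReal.toReal_nonneg, Finset.sum_filter]
    rw [← Finset.sum_erase Finset.univ (a := j) (if_neg (N.acyclic j))]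
    refine Finset.sum_congr rfl fun k hk => ?_
    split_ifs with h
    -- A segment with another one above it has finite length, so `toReal` loses nothing.
    · rw [preimage_downstream_of_above (u := ⟨j, x⟩) h, Set.image_univ, Subtype.range_coe,
        segment_eq_Icc h.len_ne_top, Real.volume_Icc, sub_zero]
    · rw [preimage_downstream_of_not_above (u := ⟨j, x⟩) h (Finset.ne_of_mem_erase hk)]
      simp

theorem depth_nonneg (u : N.Location) : 0 ≤ depth u :=
  add_nonneg (Finset.sum_nonneg fun _ _ => ENNReal.toReal_nonneg) u.2.2.1

/-- The downstream sets are nested and of finite length, so the symmetric difference is a plain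
difference. Hence distance is additive along the stream. -/
theorem hydroDist_eq_of_flowsTo {u v : N.Location} (h : FlowsTo u v) :
    hydroDist u v = depth u - depth v := by
  have hs : downstream v ⊆ downstream u := fun _ hr => h.trans hr
  have hv : N.lengthMeasure (downstream v) ≠ ∞ := by
    rw [lengthMeasure_downstream]
    exact ENNReal.ofReal_ne_top
  rw [hydroDist, symmDiff_def, sdiff_eq_bot_iff.2 hs, sup_bot_eq,
    measure_sdiff hs (measurableSet_downstream v).nullMeasurableSet hv,
    lengthMeasure_downstream, lengthMeasure_downstream,
    ← ENNReal.ofReal_sub _ (depth_nonneg v), ENNReal.toReal_ofReal]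
  have hle := measure_mono (μ := N.lengthMeasure) hs
  rw [lengthMeasure_downstream, lengthMeasure_downstream,
    ENNReal.ofReal_le_ofReal_iff (depth_nonneg u)] at hle
  exact sub_nonneg.2 hle

theorem measurable_depth : Measurable (depth : N.Location → ℝ) :=
  measurable_location fun j => measurable_subtype_coe.const_add (N.baseDepth j)

open Classical in
/-- Discounting turns the additivity of the weights into a telescoping sum: the discounted
weights of the segments that flow into a segment make up its weight discounted at its upstream
end. -/
theorem IsAdditiveWeight.mul_exp_eq_sum [DecidableEq J] {w : J → ℝ} (hw : N.IsAdditiveWeight w)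
    (hs : N.SourcesAtInfinity) (c : ℝ) (k : J) :
    w k * (if N.len k = ∞ then 0 else Real.exp (-c * (N.baseDepth k + (N.len k).toReal))) =
      ∑ i with N.down i = some k, w i * Real.exp (-c * N.baseDepth i) := by
  by_cases h : ∃ i, N.down i = some k
  · obtain ⟨i, hi⟩ := h
    rw [if_neg (N.len_ne_top k i hi), hw.additive k ⟨i, hi⟩, Finset.sum_mul]
    refine Finset.sum_congr (by congr) fun l hl => ?_
    rw [baseDepth_of_down (Finset.mem_filter.1 hl).2]
  -- At a source both sides vanish: infinite length on the left, no inflow on the right.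
  · push Not at h
    rw [if_pos (hs k h), mul_zero, Finset.filter_false_of_mem (by simpa using h),
      Finset.sum_empty]

open Classical in
/-- With infinitely distant sources, the discounted weight of the network upstream of a location
is proportional to the discounted weight of that location. -/
theorem setIntegral_upstream_exp_depth [DecidableEq J] {w : J → ℝ} (hw : N.IsAdditiveWeight w)
    (hs : N.SourcesAtInfinity) {c : ℝ} (hc : 0 < c) (u : N.Location)
    (hint : IntegrableOn (fun r : N.Location => w r.1 * Real.exp (-c * depth r)) (upstream u)
      N.lengthMeasure) :
    ∫ r in upstream u, w r.1 * Real.exp (-c * depth r) ∂N.lengthMeasure =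
      w u.1 * Real.exp (-c * depth u) / c := by
  obtain ⟨j, x⟩ := u
  -- The discount factor at the upper end of a segment, zero at infinity.
  set E : J → ℝ := fun k =>
    if N.len k = ∞ then 0 else Real.exp (-c * (N.baseDepth k + (N.len k).toReal)) with hE
  have hup := measurableSet_upstream (N := N) ⟨j, x⟩
  have hm : Measurable fun r : N.Location => w r.1 * Real.exp (-c * depth r) :=
    (measurable_location (f := fun r : N.Location => w r.1) fun k => measurable_const (a := w k)).mul
      (measurable_depth.const_mul (-c)).exp
  have hseg : ∀ k : J, ∀ y : N.segment k,
      ∫ z : N.segment k, (Set.Ici y).indicator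
        (fun z => w k * Real.exp (-c * (N.baseDepth k + z))) z
          ∂((volume : Measure ℝ).comap Subtype.val) =
        w k * ((Real.exp (-c * (N.baseDepth k + y)) - E k) / c) := by
    intro k y
    have := integral_subtype_comap (μ := volume) (measurableSet_segment (N := N) k)
      ((Set.Ici (y : ℝ)).indicator fun z => w k * Real.exp (-c * (N.baseDepth k + z)))
    rw [setIntegral_indicator measurableSet_Ici, integral_const_mul,
      setIntegral_exp_segment hc _ y.2] at this
    exact this
  have hcomp : ∀ k : J, ∫ z : N.segment k, (upstream ⟨j, x⟩).indicator
      (fun r : N.Location => w r.1 * Real.exp (-c * depth r)) ⟨k, z⟩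
        ∂((volume : Measure ℝ).comap Subtype.val) =
      (if k = j then w j * ((Real.exp (-c * (N.baseDepth j + x)) - E j) / c) else 0) +
      (if N.Above k j then w k * ((Real.exp (-c * N.baseDepth k) - E k) / c) else 0) := by
    intro k
    have hpre : ∀ z : N.segment k, (upstream ⟨j, x⟩).indicator
        (fun r : N.Location => w r.1 * Real.exp (-c * depth r)) ⟨k, z⟩ =
        (N.loc k ⁻¹' upstream ⟨j, x⟩).indicator
          (fun z => w k * Real.exp (-c * (N.baseDepth k + z))) z := fun z => rfl
    simp only [hpre]
    by_cases hk : k = j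
    · subst hk
      rw [preimage_upstream_self, hseg, if_pos rfl, if_neg fun h : N.Above k k => h.ne rfl,
        add_zero]
    · by_cases h : N.Above k j
      · rw [preimage_upstream_of_above (u := ⟨j, x⟩) h, if_neg hk, if_pos h, zero_add]
        have hb : (Set.univ : Set (N.segment k)) = Set.Ici (N.segBot k) :=
          (Set.eq_univ_of_forall fun z => z.2.1).symm
        rw [hb, hseg]
        simp [segBot]
      · rw [preimage_upstream_of_not_above (u := ⟨j, x⟩) h hk, if_neg hk, if_neg h]
        simp
  -- A segment lies above `j` exactly when it flows directly into `j` or into a segment above `j`.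
  -- So the upper-end terms of `j` and of all segments above it regroup into the lower-end terms of
  -- the segments above `j`; the groups are disjoint because each segment has only one outflow.
  have htel : w j * E j + ∑ k with N.Above k j, w k * E k =
      ∑ k with N.Above k j, w k * Real.exp (-c * N.baseDepth k) := by
    rw [← Finset.sum_insert (f := fun k => w k * E k) (by simpa using fun h : N.Above j j => h.ne rfl)]
    simp only [hE, hw.mul_exp_eq_sum hs c]
    rw [← Finset.sum_biUnion]
    · refine Finset.sum_congr ?_ fun _ _ => rfl
      ext i
      simp only [Finset.mem_biUnion, Finset.mem_insert, Finset.mem_filter, Finset.mem_univ,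
        true_and, above_iff_exists_down (i := i)]
      exact exists_congr fun k => and_comm
    · intro k _ l _ hkl
      refine Finset.disjoint_left.2 fun i hi hi' => hkl ?_
      exact Option.some.inj ((Finset.mem_filter.1 hi).2.symm.trans (Finset.mem_filter.1 hi').2)
  rw [← integral_indicator hup, integral_lengthMeasure (hint.integrable_indicator hup)
    (hm.indicator hup)]
  simp only [hcomp]
  rw [Finset.sum_add_distrib, Finset.sum_ite_eq' Finset.univ j, if_pos (Finset.mem_univ j),
    ← Finset.sum_filter]
  simp only [mul_div_assoc', mul_sub]
  rw [← Finset.sum_div, Finset.sum_sub_distrib, ← htel]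
  simp only [depth]
  ring

end Depth

end StreamNetwork

/-! ### Covariance of the tail-up model -/

namespace StreamNetwork

variable {J : Type*} {N : StreamNetwork J} {w : J → ℝ} {m : ℝ → ℝ}
  {Ω : Type*} {mΩ : MeasurableSpace Ω} {P : Measure Ω} {B Y : N.Location → Ω → ℝ}
  {μ : N.Location → ℝ}

theorem IsTailUp.memLp [IsProbabilityMeasure P] (hY : IsTailUp w m μ B Y P) (u : N.Location) :
    MemLp (Y u) 2 P := by
  have h := (hY u).2.1.add (memLp_const (μ u))
  exact h.ae_eq (Eventually.of_forall fun ω => sub_add_cancel (Y u ω) (μ u))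

theorem indicator_upstream_mul (hw : ∀ j, 0 < w j) (u v : N.Location) (r : N.Location) :
    (upstream u).indicator (fun r => m (hydroDist r u) * √(w r.1 / w u.1)) r *
        (upstream v).indicator (fun r => m (hydroDist r v) * √(w r.1 / w v.1)) r =
      (upstream u ∩ upstream v).indicator
        (fun r => m (hydroDist r u) * m (hydroDist r v) * (w r.1 / √(w u.1 * w v.1))) r := by
  rw [← Set.inter_indicator_mul]
  congr 1
  ext r
  have h := Real.mul_self_sqrt (hw r.1).le
  rw [Real.sqrt_div (hw _).le, Real.sqrt_div (hw _).le, Real.sqrt_mul (hw _).le]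
  calc _ = m (hydroDist r u) * m (hydroDist r v) *
        (√(w r.1) * √(w r.1) / (√(w u.1) * √(w v.1))) := by ring
    _ = _ := by rw [h]

theorem IsTailUp.integrableOn (hw : ∀ j, 0 < w j) (hY : IsTailUp w m μ B Y P)
    (u v : N.Location) :
    IntegrableOn (fun r => m (hydroDist r u) * m (hydroDist r v) * (w r.1 / √(w u.1 * w v.1)))
      (upstream u ∩ upstream v) N.lengthMeasure := by
  rw [← integrable_indicator_iff ((measurableSet_upstream u).inter (measurableSet_upstream v))]
  have h := (hY u).1.integrable_mul (hY v).1
  exact h.congr (Eventually.of_forall fun r => indicator_upstream_mul hw u v r)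

variable [Fintype J]

/-- The covariance function of the tail-up model. -/
theorem IsTailUp.covariance_eq [IsProbabilityMeasure P] (hw : ∀ j, 0 < w j)
    (hB : IsBrownian B P) (hY : IsTailUp w m μ B Y P) (u v : N.Location) :
    cov[Y u, Y v; P] = ∫ r in upstream u ∩ upstream v,
      m (hydroDist r u) * m (hydroDist r v) * (w r.1 / √(w u.1 * w v.1)) ∂N.lengthMeasure := by
  have hi := fun u => (hY.memLp u).integrable (by norm_num)
  have h := (hY u).covariance_eq hB (hY v)
  rw [covariance_sub_const_left (hi u), covariance_sub_const_right (hi v)] at h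
  rw [h, ← integral_indicator ((measurableSet_upstream u).inter (measurableSet_upstream v))]
  exact integral_congr_ae (Eventually.of_forall fun r => indicator_upstream_mul hw u v r)

/-- Locations that are not flow-connected are uncorrelated. -/
theorem IsTailUp.covariance_eq_zero [IsProbabilityMeasure P] (hw : ∀ j, 0 < w j)
    (hB : IsBrownian B P) (hY : IsTailUp w m μ B Y P) {u v : N.Location} (huv : ¬ FlowsTo u v)
    (hvu : ¬ FlowsTo v u) : cov[Y u, Y v; P] = 0 := by
  have h : upstream u ∩ upstream v = ∅ :=
    Set.eq_empty_of_forall_notMem fun r hr => (FlowsTo.total hr.1 hr.2).elim huv hvu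
  rw [hY.covariance_eq hw hB, h, setIntegral_empty]

theorem IsTailUp.variance_eq [IsProbabilityMeasure P] (hw : ∀ j, 0 < w j)
    (hB : IsBrownian B P) (hY : IsTailUp w m μ B Y P) (u : N.Location) :
    Var[Y u; P] = ∫ r in upstream u,
      m (hydroDist r u) * m (hydroDist r u) * (w r.1 / w u.1) ∂N.lengthMeasure := by
  rw [← covariance_self (hY.memLp u).aestronglyMeasurable.aemeasurable, hY.covariance_eq hw hB,
    Set.inter_self, Real.sqrt_mul_self (hw _).le]

section Exponential

variable {β φ : ℝ}

/-- Lack of memory of the exponential: for `r` upstream of `u`, the kernel at `v` is the kernel at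
`u` times a factor independent of `r`, and the weights split likewise. -/
theorem IsTailUp.covariance_exp [IsProbabilityMeasure P] (hw : ∀ j, 0 < w j)
    (hB : IsBrownian B P) (hY : IsTailUp w (fun h => β * Real.exp (-h / φ)) μ B Y P)
    {u v : N.Location} (huv : FlowsTo u v) :
    cov[Y u, Y v; P] = Var[Y u; P] * √(w u.1 / w v.1) * Real.exp (-hydroDist u v / φ) := by
  have hsub : upstream u ⊆ upstream v := fun _ hr => FlowsTo.trans hr huv
  rw [hY.covariance_eq hw hB, hY.variance_eq hw hB, Set.inter_eq_left.2 hsub, mul_assoc,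
    ← integral_mul_const]
  refine setIntegral_congr_fun (measurableSet_upstream u) fun r hr => ?_
  have hd : hydroDist r v = hydroDist r u + hydroDist u v := by
    rw [hydroDist_eq_of_flowsTo hr, hydroDist_eq_of_flowsTo huv,
      hydroDist_eq_of_flowsTo (hsub hr)]
    ring
  have hexp : Real.exp (-hydroDist r v / φ) =
      Real.exp (-hydroDist r u / φ) * Real.exp (-hydroDist u v / φ) := by
    rw [← Real.exp_add, hd]
    ring_nf
  have hwt : w r.1 / √(w u.1 * w v.1) = w r.1 / w u.1 * √(w u.1 / w v.1) := by
    have hu := Real.sqrt_pos.2 (hw u.1)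
    have hv := Real.sqrt_pos.2 (hw v.1)
    have h := Real.mul_self_sqrt (hw u.1).le
    rw [Real.sqrt_mul (hw _).le, Real.sqrt_div (hw _).le]
    nth_rw 2 [← h]
    field_simp
  simp only [hexp, hwt]
  ring

/-- With infinitely distant sources the exponential tail-up model has constant variance. -/
theorem IsTailUp.variance_exp [DecidableEq J] [IsProbabilityMeasure P]
    (hw : N.IsAdditiveWeight w) (hB : IsBrownian B P) (hβ : 0 < β) (hφ : 0 < φ)
    (hY : IsTailUp w (fun h => β * Real.exp (-h / φ)) μ B Y P) (hs : N.SourcesAtInfinity)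
    (u : N.Location) : Var[Y u; P] = β ^ 2 * φ / 2 := by
  -- The 2 comes from squaring the kernel; `K` collects the factors that depend on `u` alone.
  set c : ℝ := 2 / φ with hc
  have hcpos : 0 < c := by positivity
  set K : ℝ := β ^ 2 * Real.exp (c * depth u) / w u.1 with hK
  have hwu := hw.pos u.1
  have hKpos : 0 < K := by positivity
  have heq : Set.EqOn (fun r : N.Location => β * Real.exp (-hydroDist r u / φ) *
      (β * Real.exp (-hydroDist r u / φ)) * (w r.1 / w u.1))
      (fun r => K * (w r.1 * Real.exp (-c * depth r))) (upstream u) := by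
    intro r hr
    have h : Real.exp (-hydroDist r u / φ) * Real.exp (-hydroDist r u / φ) =
        Real.exp (c * depth u) * Real.exp (-c * depth r) := by
      rw [← Real.exp_add, ← Real.exp_add, hydroDist_eq_of_flowsTo hr, hc]
      ring_nf
    calc β * Real.exp (-hydroDist r u / φ) * (β * Real.exp (-hydroDist r u / φ)) *
          (w r.1 / w u.1) = β ^ 2 * (Real.exp (-hydroDist r u / φ) *
            Real.exp (-hydroDist r u / φ)) * (w r.1 / w u.1) := by ring
      _ = K * (w r.1 * Real.exp (-c * depth r)) := by
        rw [h, hK]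
        ring
  have hint := hY.integrableOn hw.pos u u
  rw [Set.inter_self, Real.sqrt_mul_self hwu.le] at hint
  -- Integrability is read off from the square integrability in the model, by dividing out `K`.
  have hint' : IntegrableOn (fun r : N.Location => w r.1 * Real.exp (-c * depth r)) (upstream u)
      N.lengthMeasure := by
    have h := (hint.congr_fun heq (measurableSet_upstream u)).const_mul K⁻¹
    simp only [inv_mul_cancel_left₀ hKpos.ne'] at h
    exact h
  rw [hY.variance_eq hw.pos hB, setIntegral_congr_fun (measurableSet_upstream u) heq,
    integral_const_mul, setIntegral_upstream_exp_depth hw hs hcpos u hint', hK, hc]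
  have h : Real.exp (2 / φ * depth u) * Real.exp (-(2 / φ) * depth u) = 1 := by
    rw [← Real.exp_add]
    simp
  calc _ = β ^ 2 * (Real.exp (2 / φ * depth u) * Real.exp (-(2 / φ) * depth u)) *
        (w u.1 / w u.1) / (2 / φ) := by ring
    _ = _ := by
      rw [h, div_self hwu.ne']
      field_simp

end Exponential

end StreamNetwork

theorem mainTheorem4 {J : Type*} [Fintype J] [DecidableEq J] (N : StreamNetwork J)
    (w : J → ℝ) (hw : N.IsAdditiveWeight w)
    {Ω : Type*} [MeasurableSpace Ω] (P : Measure Ω) [IsProbabilityMeasure P]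
    (B : N.Location → Ω → ℝ) (hB : StreamNetwork.IsBrownian B P)
    (μ : N.Location → ℝ) (Y : N.Location → Ω → ℝ) :
    -- the covariance function for a general moving average function
    (∀ m : ℝ → ℝ, StreamNetwork.IsTailUp w m μ B Y P →
      ∀ u v : N.Location,
        MemLp (Y u) 2 P ∧ MemLp (Y v) 2 P ∧
        IntegrableOn (fun r => m (StreamNetwork.hydroDist r u) * m (StreamNetwork.hydroDist r v) *
            (w r.1 / √(w u.1 * w v.1)))
          (StreamNetwork.upstream u ∩ StreamNetwork.upstream v) N.lengthMeasure ∧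
        cov[Y u, Y v; P] =
          ∫ r in StreamNetwork.upstream u ∩ StreamNetwork.upstream v,
            m (StreamNetwork.hydroDist r u) * m (StreamNetwork.hydroDist r v) *
              (w r.1 / √(w u.1 * w v.1)) ∂N.lengthMeasure) ∧
    -- the exponential moving average function
    (∀ β φ : ℝ, 0 < β → 0 < φ →
      StreamNetwork.IsTailUp w (fun h => β * Real.exp (-h / φ)) μ B Y P →
      -- on every network
      (∀ u v : N.Location, StreamNetwork.FlowsTo u v →
        cov[Y u, Y v; P] = Var[Y u; P] * √(w u.1 / w v.1) *
          Real.exp (-StreamNetwork.hydroDist u v / φ)) ∧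
      (∀ u v : N.Location, ¬ StreamNetwork.FlowsTo u v → ¬ StreamNetwork.FlowsTo v u →
        cov[Y u, Y v; P] = 0) ∧
      -- with infinitely distant sources: the variance is a constant `σ²`
      (N.SourcesAtInfinity → ∃ σ : ℝ, 0 < σ ∧ σ ^ 2 = β ^ 2 * φ / 2 ∧
        (∀ u : N.Location, Var[Y u; P] = σ ^ 2) ∧
        (∀ u v : N.Location, StreamNetwork.FlowsTo u v →
          cov[Y u, Y v; P] = σ ^ 2 * √(w u.1 / w v.1) *
            Real.exp (-StreamNetwork.hydroDist u v / φ)) ∧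
        (∀ u v : N.Location, StreamNetwork.FlowsTo v u →
          cov[Y u, Y v; P] = σ ^ 2 * √(w v.1 / w u.1) *
            Real.exp (-StreamNetwork.hydroDist v u / φ)) ∧
        (∀ u v : N.Location, ¬ StreamNetwork.FlowsTo u v → ¬ StreamNetwork.FlowsTo v u →
          cov[Y u, Y v; P] = 0))) := by
  refine ⟨fun m hY u v => ⟨hY.memLp u, hY.memLp v, hY.integrableOn hw.pos u v,
    hY.covariance_eq hw.pos hB u v⟩, fun β φ hβ hφ hY => ⟨fun u v huv =>
    hY.covariance_exp hw.pos hB huv, fun u v huv hvu => hY.covariance_eq_zero hw.pos hB huv hvu,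
    fun hs => ?_⟩⟩
  have hpos : 0 < β ^ 2 * φ / 2 := by positivity
  have hsq : √(β ^ 2 * φ / 2) ^ 2 = β ^ 2 * φ / 2 := Real.sq_sqrt hpos.le
  have hvar : ∀ u, Var[Y u; P] = √(β ^ 2 * φ / 2) ^ 2 := fun u =>
    (hY.variance_exp hw hB hβ hφ hs u).trans hsq.symm
  have hcov : ∀ u v : N.Location, StreamNetwork.FlowsTo u v →
      cov[Y u, Y v; P] = √(β ^ 2 * φ / 2) ^ 2 * √(w u.1 / w v.1) *
        Real.exp (-StreamNetwork.hydroDist u v / φ) := fun u v huv => by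
    rw [hY.covariance_exp hw.pos hB huv, hvar]
  refine ⟨√(β ^ 2 * φ / 2), Real.sqrt_pos.2 hpos, hsq, hvar, hcov, fun u v hvu => ?_,
    fun u v huv hvu => hY.covariance_eq_zero hw.pos hB huv hvu⟩
  rw [covariance_comm, hcov v u hvu]
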